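/- An \emph{abelian network} $\mathcal N$ on a directed graph $G=(V,E)$ consists of, for each vertex $v$, an input alphabet $A_v$, a state space $Q_v$, commuting transition maps $t_a : Q_v\to Q_v$ $(a\in A_v)$ and message passing functions $o_a^u : Q_v\to A_u^*$ $(a\in A_v,\ (v,u)\in E)$, such that for each initial state, input words that are equal up to permutation produce, for each $u$, output words in $A_u^*$ that are equal up to permutation. Put $A=\bigsqcup_v A_v$ and $Q=\prod_v Q_v$. Processing a letter $a\in A_v$ in a configuration $\mathbf x.\mathbf q$ ($\mathbf x\in\mathbb Z^A$, $\mathbf q\in Q$) replaces $\mathbf q_v$ by $t_a(\mathbf q_v)$ and $\mathbf x$ by $\mathbf x-1_a$ plus the vector counting the letters in the messages $o_a^u(\mathbf q_v)$. A word $w\in A^*$ is \emph{legal} for $\mathbf x.\mathbf q$ if each of its letters $a$ is processed in a configuration whose $a$-coordinate is at least $1$, and \emph{complete} if the final vector is $\le \mathbf 0$. The network \emph{halts on all inputs} if each $\mathbf x.\mathbf q$ with $\mathbf x\in\mathbb N^A$, $\mathbf q\in Q$ has a complete legal word; the final state $\mathbf x\triangleright\triangleright\mathbf q$ then does not depend on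 the choice of this word. The network is \emph{finite} if $V$ and all $A_v$, $Q_v$ are finite. Let $M_v$ be the submonoid of $\mathrm{End}(Q_v)$ generated by $\{t_a\}_{a\in A_v}$. The network is \emph{irreducible} if for every $v$ the set $Q_v$ is nonempty and any $q,q'\in Q_v$ satisfy $mq=m'q'$ for some $m,m'\in M_v$. The \emph{minimal idempotent} of a finite commutative monoid $M$ is the product $e$ of all its idempotents; $eM$ is an abelian group with identity $e$. Let $e_v$ be the minimal idempotent of $M_v$. Each $t_a$ with $a\in A_v$ permutes $e_vQ_v$, so $\mathbb Z^{A_v}$ acts on $e_vQ_v$; let $K_v$ be the kernel of this action. The \emph{total kernel} is $K=\prod_v K_v\subset\mathbb Z^A$. A state $\mathbf q\in Q$ is \emph{locally recurrent} if $\mathbf q_v\in e_vQ_v$ for all $v$. For such $\mathbf q$ and for $\mathbf k\in K\cap\mathbb N^A$, processing $\mathbf k_a$ letters $a$ for every $a\in A$ in the configuration $\mathbf k.\mathbf q$ yields a configuration $P_{\mathbf q}(\mathbf k).\mathbf q$; the map $P_{\mathbf q}$ extends uniquely to a group homomorphism $K\to\mathbb Z^A$. If $\mathcal N$ is finite and irreducible,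 this homomorphism is independent of the locally recurrent state $\mathbf q$; it is the \emph{production map} $P$. Write $I$ for the inclusion $K\hookrightarrow\mathbb Z^A$. \textbf{Theorem.} Let $\mathcal N$ be a finite irreducible abelian network that halts on all inputs. Let $M$ be the (finite, commutative) submonoid of $\mathrm{End}(Q)$ generated by the maps $\tau_a(\mathbf q)=1_a\triangleright\triangleright\mathbf q$, $a\in A$, let $e$ be its minimal idempotent, and let $\mathrm{Crit}\,\mathcal N=eM$ be the critical group. Then the group homomorphism $\phi:\mathbb Z^A\to\mathrm{Crit}\,\mathcal N$ with $\phi(1_a)=e\tau_a$ for all $a\in A$ induces an isomorphism of abelian groups \[ \mathbb Z^A/(I-P)K\;\simeq\;\mathrm{Crit}\,\mathcal N . \] -/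

import Mathlib

noncomputable section

/-! ### Finite commutative monoids and their actions -/

namespace FiniteMonoid

/-- A monoid action is irreducible if the relation `∃ m m', m • x = m' • y` has exactly one
equivalence class. -/
def IsIrreducible (M X : Type*) [CommMonoid M] [MulAction M X] : Prop :=
  Nonempty X ∧ ∀ x y : X, ∃ m m' : M, m • x = m' • y

/-- The minimal idempotent: the product of all idempotents. -/
def minIdem (M : Type*) [CommMonoid M] [Finite M] : M :=
  ∏ f ∈ (Set.toFinite {f : M | f * f = f}).toFinset, f

section

variable {M : Type*} [CommMonoid M] [Finite M]

theorem minIdem_mul_self : minIdem M * minIdem M = minIdem M := by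
  unfold minIdem
  rw [← Finset.prod_mul_distrib]
  refine Finset.prod_congr rfl fun f hf => ?_
  simpa using hf

theorem exists_idem_pow (m : M) : ∃ n : ℕ, m ^ (n + 1) * m ^ (n + 1) = m ^ (n + 1) := by
  obtain ⟨i, j, hne, hij⟩ := Finite.exists_ne_map_eq_of_infinite (fun n : ℕ => m ^ n)
  wlog hlt : i < j generalizing i j
  · exact this j i hne.symm hij.symm (by omega)
  obtain ⟨p, rfl⟩ := Nat.exists_eq_add_of_lt hlt
  have key : ∀ c n : ℕ, i ≤ n → m ^ (n + c * (p + 1)) = m ^ n := by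
    intro c
    induction c with
    | zero => simp
    | succ c ih =>
      intro n hn
      obtain ⟨d, rfl⟩ := Nat.exists_eq_add_of_le hn
      rw [show i + d + (c + 1) * (p + 1) = (i + d + (p + 1)) + c * (p + 1) by ring,
        ih _ (by omega), show i + d + (p + 1) = (i + p + 1) + d by ring, pow_add, pow_add m i d]
      exact congrArg (· * m ^ d) hij.symm
  refine ⟨i * (p + 1) + p, ?_⟩
  rw [← pow_add]
  have := key (i + 1) (i * (p + 1) + p + 1) (by nlinarith)
  rwa [show (i + 1) * (p + 1) = i * (p + 1) + p + 1 by ring] at this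

theorem exists_mul_eq_minIdem (m : M) : ∃ n : M, n * m = minIdem M := by
  obtain ⟨n, hn⟩ := exists_idem_pow m
  have hmem : m ^ (n + 1) ∈ (Set.toFinite {f : M | f * f = f}).toFinset := by simpa using hn
  obtain ⟨c, hc⟩ := Finset.dvd_prod_of_mem (fun f : M => f) hmem
  refine ⟨c * m ^ n, ?_⟩
  unfold minIdem
  rw [hc, mul_assoc, ← pow_succ, mul_comm]

end

/-- The set `eM`, where `e` is the minimal idempotent of `M`. -/
def MinIdeal (M : Type*) [CommMonoid M] [Finite M] : Type _ :=
  {x : M // ∃ m : M, x = minIdem M * m}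

namespace MinIdeal

variable {M : Type*} [CommMonoid M] [Finite M]

theorem ext {x y : MinIdeal M} (h : x.1 = y.1) : x = y := Subtype.ext h

theorem minIdem_mul (x : MinIdeal M) : minIdem M * x.1 = x.1 := by
  obtain ⟨m, hm⟩ := x.2
  rw [hm, ← mul_assoc, minIdem_mul_self]

/-- The element `e * m` of `eM`. -/
def mk (m : M) : MinIdeal M := ⟨minIdem M * m, m, rfl⟩

/-- `eM` is an abelian group under the multiplication of `M`, with identity element `e`. -/
instance : CommGroup (MinIdeal M) where
  mul x y := ⟨x.1 * y.1, x.1 * y.1, by rw [← mul_assoc, minIdem_mul]⟩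
  mul_assoc x y z := ext (mul_assoc x.1 y.1 z.1)
  mul_comm x y := ext (mul_comm x.1 y.1)
  one := ⟨minIdem M, 1, (mul_one _).symm⟩
  one_mul x := ext (minIdem_mul x)
  mul_one x := ext ((mul_comm x.1 (minIdem M)).trans (minIdem_mul x))
  inv x := mk (exists_mul_eq_minIdem x.1).choose
  inv_mul_cancel x := ext <| by
    change minIdem M * (exists_mul_eq_minIdem x.1).choose * x.1 = minIdem M
    rw [mul_assoc, (exists_mul_eq_minIdem x.1).choose_spec, minIdem_mul_self]

/-- The monoid homomorphism `M → eM`, `m ↦ e * m`. -/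
def proj : M →* MinIdeal M where
  toFun := mk
  map_one' := ext (mul_one _)
  map_mul' x y := ext <| by
    change minIdem M * (x * y) = minIdem M * x * (minIdem M * y)
    rw [mul_mul_mul_comm, minIdem_mul_self]

end MinIdeal

/-- The set `eX`, where `e` is the minimal idempotent of a monoid `M` acting on `X`. -/
def RecSet (M X : Type*) [CommMonoid M] [Finite M] [MulAction M X] : Type _ :=
  {x : X // ∃ y : X, x = minIdem M • y}

/-- The action of the group `eM` on the set `eX`. -/
instance (M X : Type*) [CommMonoid M] [Finite M] [MulAction M X] :
    MulAction (MinIdeal M) (RecSet M X) where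
  smul g x := ⟨g.1 • x.1, g.1 • x.1, by rw [← mul_smul, MinIdeal.minIdem_mul]⟩
  one_smul x := Subtype.ext <| by
    obtain ⟨y, hy⟩ := x.2
    change minIdem M • x.1 = x.1
    rw [hy, ← mul_smul, minIdem_mul_self]
  mul_smul g h x := Subtype.ext (mul_smul g.1 h.1 x.1)

end FiniteMonoid

open FiniteMonoid

/-- The group homomorphism `ℤ^A → G` (for `G` abelian) that sends each basis vector `1_a`
to `g a`. -/
def latticeHom {A G : Type*} [Fintype A] [CommGroup G] (g : A → G) : (A → ℤ) →+ Additive G where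
  toFun x := Additive.ofMul (∏ a, g a ^ x a)
  map_zero' := by simp
  map_add' x y := by simp [zpow_add, Finset.prod_mul_distrib]

/-! ### Abelian processors -/

/-- An automaton with input alphabet `I`, state space `Q` and output alphabets `(B u)`:
`trans a` is the state transition `t_a` and `out a u` the message passing function `o_a^u`. -/
structure Processor (I Q : Type*) {U : Type*} (B : U → Type*) where
  trans : I → Function.End Q
  out : I → (u : U) → Q → List (B u)

/-- The word sent to feed `u` when the input word is processed letter by letter from state `q`. -/
def Processor.outWord {I Q U : Type*} {B : U → Type*} (p : Processor I Q B) (u : U) :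
    Q → List I → List (B u)
  | _, [] => []
  | q, a :: w => p.out a u q ++ p.outWord u (p.trans a q) w

/-- An abelian processor: the state transitions commute, and permuting the input word permutes
each output word. -/
structure AbelianProcessor (I Q : Type*) {U : Type*} (B : U → Type*)
    extends Processor I Q B where
  trans_comm : ∀ a b : I, trans a * trans b = trans b * trans a
  out_perm : ∀ (q : Q) (w w' : List I), w.Perm w' → ∀ u : U,
    (toProcessor.outWord u q w).Perm (toProcessor.outWord u q w')

namespace AbelianProcessor

variable {I Q U : Type*} {B : U → Type*} (p : AbelianProcessor I Q B)

/-- The transition monoid: the submonoid of `End Q` generated by the maps `t_a`. -/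
def transMonoid : Submonoid (Function.End Q) := Submonoid.closure (Set.range p.trans)

instance : CommMonoid p.transMonoid :=
  { (inferInstance : Monoid p.transMonoid) with
    mul_comm := by
      have h := Submonoid.isMulCommutative_closure (M := Function.End Q) (s := Set.range p.trans) (by
        rintro _ ⟨a, rfl⟩ _ ⟨b, rfl⟩
        exact p.trans_comm a b)
      exact h.is_comm.comm }

instance [Finite Q] : Finite (Function.End Q) := inferInstanceAs (Finite (Q → Q))

/-- The generator `t_a` of the transition monoid. -/
def gen (a : I) : p.transMonoid := ⟨p.trans a, Submonoid.subset_closure ⟨a, rfl⟩⟩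

/-- A processor is irreducible if the action of its transition monoid on its states is. -/
def IsIrreducible : Prop := FiniteMonoid.IsIrreducible p.transMonoid Q

/-- The action of `ℤ^I` on `eQ` by permutations, in which `1_a` acts as `t_a`. -/
def latticeAction [Fintype I] [Finite Q] :
    (I → ℤ) →+ Additive (Equiv.Perm (RecSet p.transMonoid Q)) :=
  (MonoidHom.toAdditive (MulAction.toPermHom (MinIdeal p.transMonoid)
    (RecSet p.transMonoid Q))).comp (latticeHom fun a => MinIdeal.mk (p.gen a))

/-- The kernel of the action of `ℤ^I` on `eQ`. -/
def kernel [Fintype I] [Finite Q] : AddSubgroup (I → ℤ) := p.latticeAction.ker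

end AbelianProcessor

/-! ### Abelian networks -/

/-- An abelian network on the directed graph `G`, with an abelian processor at each vertex `v`
that has input alphabet `A v`, state space `Q v` and one output feed, with alphabet `A u`, for each
edge from `v` to `u`. -/
structure AbelianNetwork {V : Type*} (G : Digraph V) (A Q : V → Type*) where
  proc : (v : V) → AbelianProcessor (A v) (Q v) (fun u : {u : V // G.Adj v u} => A u.1)

namespace AbelianNetwork

variable {V : Type*} {G : Digraph V} {A Q : V → Type*} (N : AbelianNetwork G A Q)

/-- Each processor is irreducible. -/
def IsIrreducible : Prop := ∀ v, (N.proc v).IsIrreducible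

open Classical in
/-- The vector of letters sent when the processor at `a.1`, in state `s`, processes letter `a`. -/
def sent (a : Σ v, A v) (s : Q a.1) : (Σ v, A v) → ℕ := fun b =>
  if h : G.Adj a.1 b.1 then ((N.proc a.1).out a.2 ⟨b.1, h⟩ s).count b.2 else 0

open Classical in
/-- Processing of one letter `a` in the configuration `x.q`. -/
def step (a : Σ v, A v) (c : ((Σ v, A v) → ℤ) × (∀ v, Q v)) :
    ((Σ v, A v) → ℤ) × (∀ v, Q v) :=
  (c.1 - Pi.single a 1 + fun b => (N.sent a (c.2 a.1) b : ℤ),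
    Function.update c.2 a.1 ((N.proc a.1).trans a.2 (c.2 a.1)))

/-- The result of executing a word, first letter first. -/
def exec : List (Σ v, A v) → ((Σ v, A v) → ℤ) × (∀ v, Q v) → ((Σ v, A v) → ℤ) × (∀ v, Q v)
  | [], c => c
  | a :: w, c => exec w (N.step a c)

/-- A word is legal if each letter is present at the time it is processed. -/
def Legal : List (Σ v, A v) → ((Σ v, A v) → ℤ) × (∀ v, Q v) → Prop
  | [], _ => True
  | a :: w, c => 1 ≤ c.1 a ∧ Legal w (N.step a c)

/-- A word is complete if no letters remain after its execution. -/
def Complete (w : List (Σ v, A v)) (c : ((Σ v, A v) → ℤ) × (∀ v, Q v)) : Prop :=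
  (N.exec w c).1 ≤ 0

/-- Every nonnegative input, in every state, has a finite complete legal execution. -/
def HaltsOnAllInputs : Prop := ∀ (x : (Σ v, A v) → ℕ) (q : ∀ v, Q v),
  ∃ w, N.Legal w (fun a => (x a : ℤ), q) ∧ N.Complete w (fun a => (x a : ℤ), q)

section Abelian

theorem step_fst (a : Σ v, A v) (c : ((Σ v, A v) → ℤ) × (∀ v, Q v)) (b : Σ v, A v)
    [Decidable (b = a)] :
    (N.step a c).1 b = c.1 b - (if b = a then 1 else 0) + N.sent a (c.2 a.1) b := by
  by_cases h : b = a <;> simp [step, h]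

theorem sent_swap (v : V) (a b : A v) (s : Q v) (c : Σ v, A v) :
    N.sent ⟨v, a⟩ s c + N.sent ⟨v, b⟩ ((N.proc v).trans a s) c =
      N.sent ⟨v, b⟩ s c + N.sent ⟨v, a⟩ ((N.proc v).trans b s) c := by
  classical
  by_cases h : G.Adj v c.1
  · have := ((N.proc v).out_perm s [a, b] [b, a] (List.Perm.swap b a []) ⟨c.1, h⟩).count_eq c.2
    simpa [sent, h, Processor.outWord] using this
  · simp [sent, h]

theorem step_swap (a b : Σ v, A v) (c : ((Σ v, A v) → ℤ) × (∀ v, Q v)) :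
    N.step b (N.step a c) = N.step a (N.step b c) := by
  classical
  obtain ⟨v, a⟩ := a
  obtain ⟨u, b⟩ := b
  obtain ⟨x, q⟩ := c
  by_cases huv : u = v
  · subst huv
    refine Prod.ext ?_ ?_
    · funext l
      have h := N.sent_swap u a b (q u) l
      have h' : (N.sent ⟨u, a⟩ (q u) l : ℤ) + N.sent ⟨u, b⟩ ((N.proc u).trans a (q u)) l =
        N.sent ⟨u, b⟩ (q u) l + N.sent ⟨u, a⟩ ((N.proc u).trans b (q u)) l := by exact_mod_cast h
      simp only [step, Function.update_self, Pi.add_apply, Pi.sub_apply]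
      linarith
    · simp only [step, Function.update_self, Function.update_idem]
      exact congrArg _ (congrFun ((N.proc u).trans_comm b a) (q u))
  · refine Prod.ext ?_ ?_
    · funext l
      simp only [step, Pi.add_apply, Pi.sub_apply, Function.update_of_ne huv,
        Function.update_of_ne (Ne.symm huv)]
      ring
    · simp only [step, Function.update_of_ne huv, Function.update_of_ne (Ne.symm huv)]
      exact Function.update_comm (Ne.symm huv) _ _ _

theorem exec_append (w w' : List (Σ v, A v)) (c : ((Σ v, A v) → ℤ) × (∀ v, Q v)) :
    N.exec (w ++ w') c = N.exec w' (N.exec w c) := by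
  induction w generalizing c with
  | nil => rfl
  | cons a w ih => exact ih _

/-- The result of an execution depends only on how often each letter occurs. -/
theorem exec_perm {w w' : List (Σ v, A v)} (h : w.Perm w')
    (c : ((Σ v, A v) → ℤ) × (∀ v, Q v)) : N.exec w c = N.exec w' c := by
  induction h generalizing c with
  | nil => rfl
  | cons a _ ih => exact ih _
  | swap a b l => simp only [exec, N.step_swap a b c]
  | trans _ _ ih ih' => exact (ih c).trans (ih' c)

theorem exec_shift (w : List (Σ v, A v)) (x y : (Σ v, A v) → ℤ) (q : ∀ v, Q v) :
    N.exec w (x + y, q) = ((N.exec w (x, q)).1 + y, (N.exec w (x, q)).2) := by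
  induction w generalizing x q with
  | nil => rfl
  | cons a w ih =>
    have : N.step a (x + y, q) = ((N.step a (x, q)).1 + y, (N.step a (x, q)).2) := by
      refine Prod.ext ?_ rfl
      funext l
      simp only [step, Pi.add_apply, Pi.sub_apply]
      ring
    simp only [exec, this]
    exact ih _ _

theorem le_exec_of_notMem (w : List (Σ v, A v)) (c : ((Σ v, A v) → ℤ) × (∀ v, Q v))
    (a : Σ v, A v) (h : a ∉ w) : c.1 a ≤ (N.exec w c).1 a := by
  classical
  induction w generalizing c with
  | nil => exact le_rfl
  | cons b w ih =>
    rw [List.mem_cons, not_or] at h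
    refine le_trans ?_ (ih (N.step b c) h.2)
    rw [step_fst, if_neg h.1]
    simp

/-- Least action principle: no letter is processed more often in a legal execution than in a
complete one. -/
theorem legal_subperm (w w' : List (Σ v, A v)) (c : ((Σ v, A v) → ℤ) × (∀ v, Q v))
    (hw : N.Legal w c) (hw' : N.Complete w' c) : w.Subperm w' := by
  classical
  induction w generalizing c w' with
  | nil => exact List.nil_subperm
  | cons a w ih =>
    have ha : a ∈ w' := by
      by_contra hn
      have h1 := N.le_exec_of_notMem w' c a hn
      have h2 : (N.exec w' c).1 a ≤ 0 := hw' a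
      have h3 : 1 ≤ c.1 a := hw.1
      omega
    have hp := List.perm_cons_erase ha
    refine (hp.subperm_left).2 ((List.subperm_cons a).2 (ih (w'.erase a) (N.step a c) hw.2 ?_))
    have := N.exec_perm hp c
    unfold Complete at hw' ⊢
    rw [this] at hw'
    exact hw'

theorem legal_shift (w : List (Σ v, A v)) (x y : (Σ v, A v) → ℤ) (q : ∀ v, Q v)
    (hy : 0 ≤ y) (hw : N.Legal w (x, q)) : N.Legal w (x + y, q) := by
  induction w generalizing x q with
  | nil => trivial
  | cons a w ih =>
    have h := N.exec_shift [a] x y q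
    simp only [exec] at h
    refine ⟨?_, ?_⟩
    · have h1 : 1 ≤ x a := hw.1
      have h2 : 0 ≤ y a := hy a
      change 1 ≤ x a + y a
      omega
    · rw [h]
      exact ih _ _ hw.2

theorem legal_append (w w' : List (Σ v, A v)) (c : ((Σ v, A v) → ℤ) × (∀ v, Q v))
    (hw : N.Legal w c) (hw' : N.Legal w' (N.exec w c)) : N.Legal (w ++ w') c := by
  induction w generalizing c with
  | nil => exact hw'
  | cons a w ih => exact ⟨hw.1, ih _ hw.2 hw'⟩

theorem exec_nonneg (w : List (Σ v, A v)) (c : ((Σ v, A v) → ℤ) × (∀ v, Q v))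
    (hc : 0 ≤ c.1) (hw : N.Legal w c) : 0 ≤ (N.exec w c).1 := by
  classical
  induction w generalizing c with
  | nil => exact hc
  | cons a w ih =>
    refine ih _ (fun b => ?_) hw.2
    have h1 : 1 ≤ c.1 a := hw.1
    have h2 : 0 ≤ c.1 b := hc b
    rw [step_fst]
    by_cases h : b = a
    · subst h
      rw [if_pos rfl]
      change (0 : ℤ) ≤ _
      omega
    · rw [if_neg h]
      change (0 : ℤ) ≤ _
      omega

end Abelian

section Global

variable {N} (hN : N.HaltsOnAllInputs)

/-- The global action: the final state reached from the input `x` and the state `q` by a complete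
legal execution. -/
def globalAct (x : (Σ v, A v) → ℕ) (q : ∀ v, Q v) : ∀ v, Q v :=
  (N.exec (hN x q).choose (fun a => (x a : ℤ), q)).2

/-- The final state does not depend on the choice of the complete legal execution. -/
theorem globalAct_eq (x : (Σ v, A v) → ℕ) (q : ∀ v, Q v) (w : List (Σ v, A v))
    (hw : N.Legal w (fun a => (x a : ℤ), q)) (hw' : N.Complete w (fun a => (x a : ℤ), q)) :
    globalAct hN x q = (N.exec w (fun a => (x a : ℤ), q)).2 := by
  obtain ⟨h1, h2⟩ := (hN x q).choose_spec
  exact congrArg Prod.snd (N.exec_perm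
    ((N.legal_subperm _ _ _ h1 hw').antisymm (N.legal_subperm _ _ _ hw h2)) _)

theorem globalAct_add (x y : (Σ v, A v) → ℕ) (q : ∀ v, Q v) :
    globalAct hN (x + y) q = globalAct hN y (globalAct hN x q) := by
  obtain ⟨w, hl, hc⟩ := hN x q
  have hx := globalAct_eq hN x q w hl hc
  obtain ⟨w', hl', hc'⟩ := hN y (globalAct hN x q)
  have hy := globalAct_eq hN y _ w' hl' hc'
  have h0 : (N.exec w (fun a => (x a : ℤ), q)).1 = 0 :=
    le_antisymm hc (N.exec_nonneg _ _ (fun a => Int.natCast_nonneg _) hl)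
  have hxy : (fun a => (((x + y) a : ℕ) : ℤ)) = (fun a => (x a : ℤ)) + fun a => (y a : ℤ) := by
    funext a
    simp
  have he : N.exec w (fun a => (((x + y) a : ℕ) : ℤ), q) =
      (fun a => (y a : ℤ), globalAct hN x q) := by
    rw [hxy, N.exec_shift, h0, zero_add, hx]
  rw [globalAct_eq hN (x + y) q (w ++ w') ?_ ?_, N.exec_append, he, hy]
  · refine N.legal_append _ _ _ ?_ (he ▸ hl')
    rw [hxy]
    exact N.legal_shift _ _ _ _ (fun a => Int.natCast_nonneg _) hl
  · unfold Complete
    rw [N.exec_append, he]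
    exact hc'

open Classical in
/-- The map `τ_a` on states, which adds one letter `a` and runs the network until it halts. -/
def tau (a : Σ v, A v) : Function.End (∀ v, Q v) := fun q => globalAct hN (Pi.single a 1) q

theorem tau_comm (a b : Σ v, A v) : tau hN a * tau hN b = tau hN b * tau hN a := by
  classical
  funext q
  change globalAct hN _ (globalAct hN _ q) = globalAct hN _ (globalAct hN _ q)
  rw [← globalAct_add, ← globalAct_add, add_comm]

/-- The global monoid, generated by the maps `τ_a`. -/
def globalMonoid : Submonoid (Function.End (∀ v, Q v)) := Submonoid.closure (Set.range (tau hN))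

instance : CommMonoid (globalMonoid hN) :=
  { (inferInstance : Monoid (globalMonoid hN)) with
    mul_comm := by
      have h := Submonoid.isMulCommutative_closure (M := Function.End (∀ v, Q v))
        (s := Set.range (tau hN)) (by
        rintro _ ⟨a, rfl⟩ _ ⟨b, rfl⟩
        exact tau_comm hN a b)
      exact h.is_comm.comm }

/-- The generator `τ_a` of the global monoid. -/
def tauGen (a : Σ v, A v) : globalMonoid hN := ⟨tau hN a, Submonoid.subset_closure ⟨a, rfl⟩⟩

/-- The critical group `eM`, where `e` is the minimal idempotent of the global monoid `M`. -/
abbrev Crit [Finite V] [∀ v, Finite (Q v)] : Type _ := MinIdeal (globalMonoid hN)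

/-- The group homomorphism `ℤ^A → Crit N` that sends `1_a` to `e τ_a`. -/
def toCrit [Fintype V] [∀ v, Fintype (A v)] [∀ v, Finite (Q v)] :
    ((Σ v, A v) → ℤ) →+ Additive (Crit hN) :=
  latticeHom fun a => MinIdeal.mk (tauGen hN a)

end Global

/-! ### The total kernel and the production map -/

section Production

/-- A state `q` is locally recurrent if `q_v ∈ e_v Q_v` for all `v`, where `e_v` is the minimal
idempotent of the transition monoid at `v`. -/
def LocallyRecurrent [∀ v, Finite (Q v)] (q : ∀ v, Q v) : Prop :=
  ∀ v, ∃ s : Q v, q v = minIdem (N.proc v).transMonoid • s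

/-- The total kernel `K = ∏ K_v`, as a subgroup of `ℤ^A`. -/
def totalKernel [∀ v, Fintype (A v)] [∀ v, Finite (Q v)] : AddSubgroup ((Σ v, A v) → ℤ) where
  carrier := {x | ∀ v, (fun a => x ⟨v, a⟩) ∈ (N.proc v).kernel}
  zero_mem' v := (N.proc v).kernel.zero_mem
  add_mem' hx hy v := (N.proc v).kernel.add_mem (hx v) (hy v)
  neg_mem' hx v := (N.proc v).kernel.neg_mem (hx v)

theorem exec_snd (w : List (Σ v, A v)) (c : ((Σ v, A v) → ℤ) × (∀ v, Q v)) (v : V)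
    [Fintype (A v)] [DecidableEq (Σ v, A v)] :
    (N.exec w c).2 v = (∏ a : A v, (N.proc v).gen a ^ w.count ⟨v, a⟩) • c.2 v := by
  classical
  induction w generalizing c with
  | nil => simp [exec]
  | cons b w ih =>
    rw [exec, ih]
    obtain ⟨u, b⟩ := b
    by_cases huv : u = v
    · subst huv
      have h1 : (N.step ⟨u, b⟩ c).2 u = (N.proc u).gen b • c.2 u := by
        simp only [step, Function.update_self]
        rfl
      have h2 : ∀ a : A u, List.count (⟨u, a⟩ : Σ v, A v) (⟨u, b⟩ :: w) =
          List.count ⟨u, a⟩ w + if a = b then 1 else 0 := by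
        intro a
        by_cases hab : a = b
        · subst hab
          simp
        · rw [List.count_cons_of_ne, if_neg hab, add_zero]
          intro h
          exact hab (by simpa using h.symm)
      simp_rw [h1, h2, pow_add, Finset.prod_mul_distrib, pow_ite, pow_one, pow_zero,
        Finset.prod_ite_eq' Finset.univ b, if_pos (Finset.mem_univ b), mul_smul]
    · have h1 : (N.step ⟨u, b⟩ c).2 v = c.2 v := by
        simp only [step]
        exact Function.update_of_ne (Ne.symm huv) _ _
      have h2 : ∀ a : A v, List.count (⟨v, a⟩ : Σ v, A v) (⟨u, b⟩ :: w) =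
          List.count ⟨v, a⟩ w := by
        intro a
        rw [List.count_cons_of_ne]
        intro h
        exact huv (congrArg Sigma.fst h)
      simp_rw [h1, h2]

theorem kernel_smul [∀ v, Fintype (A v)] [∀ v, Finite (Q v)] {q : ∀ v, Q v}
    (hq : N.LocallyRecurrent q) (k : (Σ v, A v) → ℕ)
    (hk : (fun a => (k a : ℤ)) ∈ N.totalKernel) (v : V) :
    (∏ a : A v, (N.proc v).gen a ^ k ⟨v, a⟩) • q v = q v := by
  obtain ⟨r, hr⟩ : ∃ r : RecSet (N.proc v).transMonoid (Q v), r.1 = q v := ⟨⟨q v, hq v⟩, rfl⟩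
  have h : (∏ a : A v, (MinIdeal.mk ((N.proc v).gen a)) ^ ((k ⟨v, a⟩ : ℕ) : ℤ)) • r = r :=
    Equiv.congr_fun (congrArg Additive.toMul ((AddMonoidHom.mem_ker).1 (hk v))) r
  have h2 : (∏ a : A v, (MinIdeal.mk ((N.proc v).gen a)) ^ ((k ⟨v, a⟩ : ℕ) : ℤ)) =
      MinIdeal.proj (∏ a : A v, (N.proc v).gen a ^ k ⟨v, a⟩) := by
    rw [map_prod]
    refine Finset.prod_congr rfl fun a _ => ?_
    rw [zpow_natCast, map_pow]
    rfl
  rw [h2] at h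
  have h3 : (minIdem (N.proc v).transMonoid * ∏ a : A v, (N.proc v).gen a ^ k ⟨v, a⟩) • r.1
      = r.1 := congrArg Subtype.val h
  rw [hr] at h3
  obtain ⟨s, hs⟩ := hq v
  rwa [mul_comm, mul_smul, hs, ← mul_smul (minIdem _) (minIdem _), minIdem_mul_self, ← hs] at h3

variable [Fintype V] [∀ v, Fintype (A v)]

/-- A word in which each letter `a` occurs `x a` times. -/
def wordOf (x : (Σ v, A v) → ℕ) : List (Σ v, A v) :=
  (∑ a, Multiset.replicate (x a) a).toList

/-- The local action: `x ▷ (y.q)` is the result of executing a word with letter counts `x`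
in the configuration `(x + y).q`. -/
def localAct (x : (Σ v, A v) → ℕ) (c : ((Σ v, A v) → ℤ) × (∀ v, Q v)) :
    ((Σ v, A v) → ℤ) × (∀ v, Q v) :=
  N.exec (wordOf x) ((fun a => (x a : ℤ)) + c.1, c.2)

theorem count_wordOf [DecidableEq (Σ v, A v)] (x : (Σ v, A v) → ℕ) (a : Σ v, A v) :
    (wordOf x).count a = x a := by
  rw [wordOf, ← Multiset.coe_count, Multiset.coe_toList, Multiset.count_sum']
  simp [Multiset.count_replicate]

theorem localAct_zero (x : (Σ v, A v) → ℕ) (q : ∀ v, Q v) :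
    N.localAct x (0, q) = N.exec (wordOf x) (fun a => (x a : ℤ), q) := by
  simp [localAct]

variable [∀ v, Finite (Q v)] {q : ∀ v, Q v}

theorem localAct_snd (hq : N.LocallyRecurrent q) (k : (Σ v, A v) → ℕ)
    (hk : (fun a => (k a : ℤ)) ∈ N.totalKernel) : (N.localAct k (0, q)).2 = q := by
  classical
  funext v
  rw [localAct_zero, exec_snd]
  simp_rw [count_wordOf]
  exact N.kernel_smul hq k hk v

theorem localAct_add (hq : N.LocallyRecurrent q) (k l : (Σ v, A v) → ℕ)
    (hk : (fun a => (k a : ℤ)) ∈ N.totalKernel) :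
    (N.localAct (k + l) (0, q)).1 = (N.localAct k (0, q)).1 + (N.localAct l (0, q)).1 := by
  classical
  have hp : (wordOf (k + l)).Perm (wordOf k ++ wordOf l) := by
    rw [List.perm_iff_count]
    intro a
    simp [count_wordOf]
  have hkl : (fun a => (((k + l) a : ℕ) : ℤ)) = (fun a => (k a : ℤ)) + fun a => (l a : ℤ) := by
    funext a
    simp
  have h2 := N.localAct_snd hq k hk
  rw [localAct_zero] at h2
  simp only [localAct_zero]
  rw [N.exec_perm hp, N.exec_append, hkl, N.exec_shift, h2, add_comm _ (fun a => (l a : ℤ)),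
    N.exec_shift, add_comm]

theorem exists_diff (k : (Σ v, A v) → ℤ) (hk : k ∈ N.totalKernel) :
    ∃ l m : (Σ v, A v) → ℕ, (fun a => (l a : ℤ)) ∈ N.totalKernel ∧
      (fun a => (m a : ℤ)) ∈ N.totalKernel ∧ k = (fun a => (l a : ℤ)) - fun a => (m a : ℤ) := by
  have hfin : ∀ v, Finite (Equiv.Perm (RecSet (N.proc v).transMonoid (Q v))) := by
    intro v
    have : Finite (RecSet (N.proc v).transMonoid (Q v)) :=
      inferInstanceAs (Finite {x : Q v // ∃ y : Q v, x = minIdem (N.proc v).transMonoid • y})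
    infer_instance
  set c : V → ℕ := fun v => Nat.card (Equiv.Perm (RecSet (N.proc v).transMonoid (Q v)))
  set n : ℕ := ∏ v, c v
  have hn : 1 ≤ n := Finset.prod_pos fun v _ => Nat.card_pos
  have hK : ∀ x : (Σ v, A v) → ℤ, n • x ∈ N.totalKernel := by
    intro x v
    obtain ⟨d, hd⟩ : c v ∣ n := Finset.dvd_prod_of_mem c (Finset.mem_univ v)
    change n • (fun a => x ⟨v, a⟩) ∈ (N.proc v).latticeAction.ker
    rw [AddMonoidHom.mem_ker, map_nsmul, hd, mul_comm, mul_nsmul']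
    have : c v • (N.proc v).latticeAction (fun a => x ⟨v, a⟩) = 0 :=
      congrArg Additive.ofMul (pow_card_eq_one' (x := Additive.toMul
        ((N.proc v).latticeAction (fun a => x ⟨v, a⟩))))
    rw [this, nsmul_zero]
  have hm : (fun a => ((n * (k a).natAbs : ℕ) : ℤ)) ∈ N.totalKernel := by
    have := hK fun a => ((k a).natAbs : ℤ)
    convert this using 1
    funext a
    simp
  have hnn : ∀ a, 0 ≤ k a + ((n * (k a).natAbs : ℕ) : ℤ) := by
    intro a
    have h1 : (k a).natAbs ≤ n * (k a).natAbs := Nat.le_mul_of_pos_left _ hn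
    omega
  have hl : (fun a => (((k a + ((n * (k a).natAbs : ℕ) : ℤ)).toNat : ℕ) : ℤ)) =
      k + fun a => ((n * (k a).natAbs : ℕ) : ℤ) := by
    funext a
    exact Int.toNat_of_nonneg (hnn a)
  refine ⟨fun a => (k a + ((n * (k a).natAbs : ℕ) : ℤ)).toNat, fun a => n * (k a).natAbs,
    ?_, hm, ?_⟩
  · rw [hl]
    exact N.totalKernel.add_mem hk hm
  · rw [hl, add_sub_cancel_right]

/-- For locally recurrent `q`, the map `P_q` on `K ∩ ℕ^A` given by `k ▷ q = P_q(k).q` extends to a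
group homomorphism on `K`. -/
theorem exists_production (hq : N.LocallyRecurrent q) :
    ∃ P : N.totalKernel →+ ((Σ v, A v) → ℤ), ∀ (k : (Σ v, A v) → ℕ)
      (hk : (fun a => (k a : ℤ)) ∈ N.totalKernel), N.localAct k (0, q) = (P ⟨_, hk⟩, q) := by
  choose l m hl hm hlm using fun k : N.totalKernel => N.exists_diff k.1 k.2
  have key : ∀ x y z t : (Σ v, A v) → ℕ, (fun a => (x a : ℤ)) ∈ N.totalKernel →
      (fun a => (z a : ℤ)) ∈ N.totalKernel → x + y = z + t →
      (N.localAct x (0, q)).1 + (N.localAct y (0, q)).1 =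
        (N.localAct z (0, q)).1 + (N.localAct t (0, q)).1 := by
    intro x y z t hx hz h
    rw [← N.localAct_add hq x y hx, h, N.localAct_add hq z t hz]
  refine ⟨AddMonoidHom.mk' (fun k => (N.localAct (l k) (0, q)).1 - (N.localAct (m k) (0, q)).1)
    ?_, ?_⟩
  · intro x y
    have hmem : ∀ x y : (Σ v, A v) → ℕ, (fun a => (x a : ℤ)) ∈ N.totalKernel →
        (fun a => (y a : ℤ)) ∈ N.totalKernel →
        (fun a => (((x + y) a : ℕ) : ℤ)) ∈ N.totalKernel := by
      intro x y hx hy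
      convert N.totalKernel.add_mem hx hy using 1
      funext a
      simp
    have h := key (l (x + y)) (m x + m y) (l x + l y) (m (x + y)) (hl _)
      (hmem _ _ (hl x) (hl y)) (by
        funext a
        have h1 := congrFun (hlm x) a
        have h2 := congrFun (hlm y) a
        have h3 := congrFun (hlm (x + y)) a
        simp only [AddSubgroup.coe_add, Pi.add_apply, Pi.sub_apply] at h1 h2 h3
        simp only [Pi.add_apply]
        omega)
    rw [N.localAct_add hq _ _ (hm x), N.localAct_add hq _ _ (hl x)] at h
    rw [sub_add_sub_comm, sub_eq_sub_iff_add_eq_add]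
    exact h
  · intro k hk
    refine Prod.ext ?_ (N.localAct_snd hq k hk)
    have h := key k (m ⟨_, hk⟩) (l ⟨_, hk⟩) 0 hk (hl _) (by
      funext a
      have h1 := congrFun (hlm ⟨_, hk⟩) a
      simp only [Pi.sub_apply] at h1
      simp only [Pi.add_apply, Pi.zero_apply]
      omega)
    have h0 : (N.localAct 0 (0, q)).1 = 0 := by
      have := N.localAct_add hq 0 0 (by
        convert N.totalKernel.zero_mem using 1
        funext a
        simp)
      simpa using this
    rw [h0, add_zero] at h
    exact eq_sub_of_add_eq h

/-- The production map `P = P_q : K → ℤ^A`: the group homomorphism with `k ▷ q = P(k).q` for all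
`k ∈ K ∩ ℕ^A`. It is determined by this property, since `K` is generated by `K ∩ ℕ^A`. -/
def production (hq : N.LocallyRecurrent q) : N.totalKernel →+ ((Σ v, A v) → ℤ) :=
  (N.exists_production hq).choose

end Production

end AbelianNetwork

end

/-!
Fix a locally recurrent state `q` and write inputs `x, y ∈ ℕ^A`. Two conditions turn out to be
equivalent to the existence of a common extra input `z` for which `(z + x) ▷▷ q = (z + y) ▷▷ q`.

* `φ x = φ y`. The global monoid acts faithfully and irreducibly on `Q`, so two of its elements
  that agree at the single state `q` agree everywhere after multiplication by `e`. Conversely, any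
  `z` that acts as `e` will do.
* `x - y ∈ (I - P) K`. If the complete executions of `z + x` and `z + y` process the letters `u` and
  `u'`, they send `u - (z + x)` and `u' - (z + y)` letters. When they end in the same state,
  `u - u'` lies in `K` by irreducibility, and comparing the letters sent gives
  `P (u - u') = (u - u') - (x - y)`. Conversely, `k ▷▷ q = P k ▷▷ q` for `k ∈ K ∩ ℕ^A`, because
  `k ▷ q = P(k).q`; if `x - y = (I - P)(l - m)` with `l, m ∈ K ∩ ℕ^A`, then `z = l + m` works.
-/

/-- `xᶻ` is the vector `x ∈ ℕ^A`, regarded as an element of `ℤ^A`. -/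
local notation:max x "ᶻ" => fun a => ((x a : ℕ) : ℤ)

theorem natCast_pi_add {A : Type*} (x y : A → ℕ) : (x + y)ᶻ = xᶻ + yᶻ := by
  ext a
  simp

theorem exists_eq_natCast_pi_sub {A : Type*} (x : A → ℤ) : ∃ u v : A → ℕ, x = uᶻ - vᶻ := by
  refine ⟨fun a => (x a).toNat, fun a => (-x a).toNat, funext fun a => ?_⟩
  simp only [Pi.sub_apply]
  omega

theorem closure_range_mk_eq_top {I M : Type*} [Monoid M] (f : I → M) :
    Submonoid.closure (Set.range fun i => (⟨f i, Submonoid.subset_closure (Set.mem_range_self i)⟩ :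
      Submonoid.closure (Set.range f))) = ⊤ := by
  refine Eq.trans (congrArg _ ?_) (Submonoid.closure_closure_coe_preimage (s := Set.range f))
  ext m
  simp only [Set.mem_range, Set.mem_preimage, Subtype.ext_iff]

theorem exists_prod_pow_eq {A M : Type*} [Fintype A] [CommMonoid M] {g : A → M}
    (hg : Submonoid.closure (Set.range g) = ⊤) (m : M) : ∃ x : A → ℕ, ∏ a, g a ^ x a = m := by
  obtain ⟨x, hx⟩ := Submonoid.exists_of_mem_closure_range g m (hg ▸ Submonoid.mem_top m)
  exact ⟨x, hx.symm⟩

namespace FiniteMonoid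

section

variable {M X : Type*} [CommMonoid M] [Finite M] [MulAction M X]

theorem IsIrreducible.minIdem_mul_smul_eq (h : IsIrreducible M X) {m m' : M} {x : X}
    (hx : m • x = m' • x) (y : X) : (minIdem M * m) • y = (minIdem M * m') • y := by
  obtain ⟨n, n', hn⟩ := h.2 y x
  obtain ⟨c, hc⟩ := exists_mul_eq_minIdem n
  have transport (l : M) : (minIdem M * l) • y = (c * n') • l • x := by
    calc (minIdem M * l) • y = (c * l) • n • y := by rw [← hc, mul_right_comm, mul_smul]
      _ = (c * l) • n' • x := by rw [hn]
      _ = (c * n') • l • x := by rw [← mul_smul, ← mul_smul, mul_right_comm]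
  rw [transport, transport, hx]

variable [FaithfulSMul M X]

theorem IsIrreducible.proj_eq_of_smul_eq (h : IsIrreducible M X) {m m' : M} {x : X}
    (hx : m • x = m' • x) : MinIdeal.proj m = MinIdeal.proj m' :=
  MinIdeal.ext (eq_of_smul_eq_smul (h.minIdem_mul_smul_eq hx))

theorem IsIrreducible.proj_eq_iff (h : IsIrreducible M X) {m m' : M} (x : X) :
    MinIdeal.proj m = MinIdeal.proj m' ↔ ∃ c : M, (c * m) • x = (c * m') • x := by
  refine ⟨fun hm => ⟨minIdem M, congrArg (·.1 • x) hm⟩, fun ⟨c, hc⟩ => ?_⟩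
  have hproj := h.proj_eq_of_smul_eq hc
  rw [map_mul, map_mul] at hproj
  exact mul_left_cancel hproj

end

section

variable {A M X : Type*} [Fintype A] [CommMonoid M] [Finite M] [MulAction M X] {g : A → M}

variable (g) in
theorem latticeHom_mk_natCast (x : A → ℕ) :
    latticeHom (fun a => MinIdeal.mk (g a)) xᶻ =
      Additive.ofMul (MinIdeal.proj (∏ a, g a ^ x a)) := by
  simp only [map_prod, map_pow, latticeHom, AddMonoidHom.coe_mk, ZeroHom.coe_mk, zpow_natCast]
  rfl

theorem latticeHom_mk_surjective (hg : Submonoid.closure (Set.range g) = ⊤) :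
    Function.Surjective (latticeHom fun a => MinIdeal.mk (g a)) := by
  intro y
  obtain ⟨m, hm⟩ := (Additive.toMul y).2
  obtain ⟨x, rfl⟩ := exists_prod_pow_eq hg m
  exact ⟨xᶻ, (latticeHom_mk_natCast g x).trans (congrArg Additive.ofMul (MinIdeal.ext hm.symm))⟩

theorem IsIrreducible.latticeHom_mk_eq_iff [FaithfulSMul M X] (h : IsIrreducible M X)
    (hg : Submonoid.closure (Set.range g) = ⊤) (x y : A → ℕ) (q : X) :
    latticeHom (fun a => MinIdeal.mk (g a)) xᶻ = latticeHom (fun a => MinIdeal.mk (g a)) yᶻ ↔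
      ∃ z : A → ℕ, (∏ a, g a ^ (z + x) a) • q = (∏ a, g a ^ (z + y) a) • q := by
  rw [latticeHom_mk_natCast, latticeHom_mk_natCast, Additive.ofMul.apply_eq_iff_eq,
    h.proj_eq_iff q]
  simp only [Pi.add_apply, pow_add, Finset.prod_mul_distrib]
  constructor
  · rintro ⟨c, hc⟩
    obtain ⟨z, rfl⟩ := exists_prod_pow_eq hg c
    exact ⟨z, hc⟩
  · rintro ⟨z, hz⟩
    exact ⟨_, hz⟩

end

end FiniteMonoid

open FiniteMonoid

theorem AbelianProcessor.IsIrreducible.sub_mem_kernel {I Q U : Type*} {B : U → Type*}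
    {p : AbelianProcessor I Q B} [Fintype I] [Finite Q] (hp : p.IsIrreducible) {x y : I → ℕ}
    {s : Q} (h : (∏ a, p.gen a ^ x a) • s = (∏ a, p.gen a ^ y a) • s) :
    xᶻ - yᶻ ∈ p.kernel := by
  have hlattice : latticeHom (fun a => MinIdeal.mk (p.gen a)) xᶻ =
      latticeHom (fun a => MinIdeal.mk (p.gen a)) yᶻ := by
    rw [latticeHom_mk_natCast, latticeHom_mk_natCast, hp.proj_eq_of_smul_eq h]
  rw [kernel, AddMonoidHom.mem_ker, map_sub, sub_eq_zero, latticeAction, AddMonoidHom.comp_apply,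
    AddMonoidHom.comp_apply, hlattice]

namespace AbelianNetwork

variable {V : Type*} {G : Digraph V} {A Q : V → Type*} {N : AbelianNetwork G A Q}

theorem legal_of_count_le [DecidableEq (Σ v, A v)] {w : List (Σ v, A v)}
    {c : ((Σ v, A v) → ℤ) × (∀ v, Q v)} (h : ∀ a, (w.count a : ℤ) ≤ c.1 a) : N.Legal w c := by
  induction w generalizing c with
  | nil => trivial
  | cons b w ih =>
    simp only [List.count_cons, beq_iff_eq] at h
    refine ⟨?_, ih fun a => ?_⟩
    · have hb := h b
      simp only [if_true] at hb
      omega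
    · have ha := h a
      rw [step_fst]
      split_ifs at ha ⊢ <;> grind

section LocalAction

variable [Fintype V] [∀ v, Fintype (A v)]

theorem localAct_count [DecidableEq (Σ v, A v)] (w : List (Σ v, A v)) (q : ∀ v, Q v) :
    N.localAct w.count (0, q) = N.exec w (w.countᶻ, q) := by
  rw [localAct_zero]
  exact N.exec_perm (List.perm_iff_count.2 (count_wordOf _)) _

theorem localAct_snd_apply (x : (Σ v, A v) → ℕ) (q : ∀ v, Q v) (v : V) :
    (N.localAct x (0, q)).2 v = (∏ a : A v, (N.proc v).gen a ^ x ⟨v, a⟩) • q v := by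
  classical
  simp only [localAct_zero, exec_snd, count_wordOf]

theorem legal_wordOf (x : (Σ v, A v) → ℕ) (q : ∀ v, Q v) : N.Legal (wordOf x) (xᶻ, q) := by
  classical
  exact legal_of_count_le fun a => by rw [count_wordOf]

theorem exists_natCast_eq_localAct_fst (x : (Σ v, A v) → ℕ) (q : ∀ v, Q v) :
    ∃ y : (Σ v, A v) → ℕ, (N.localAct x (0, q)).1 = yᶻ := by
  have hnonneg : 0 ≤ (N.localAct x (0, q)).1 := by
    rw [localAct_zero]
    exact N.exec_nonneg _ _ (fun a => Int.natCast_nonneg (x a)) (legal_wordOf x q)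
  exact ⟨fun a => ((N.localAct x (0, q)).1 a).toNat,
    funext fun a => (Int.toNat_of_nonneg (hnonneg a)).symm⟩

theorem IsIrreducible.exists_localAct_snd_eq (hirr : N.IsIrreducible) (q r : ∀ v, Q v) :
    ∃ x y : (Σ v, A v) → ℕ, (N.localAct x (0, q)).2 = (N.localAct y (0, r)).2 := by
  have hlocal (v : V) : ∃ x y : A v → ℕ,
      (∏ a, (N.proc v).gen a ^ x a) • q v = (∏ a, (N.proc v).gen a ^ y a) • r v := by
    obtain ⟨m, m', hm⟩ := (hirr v).2 (q v) (r v)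
    obtain ⟨x, rfl⟩ := exists_prod_pow_eq (closure_range_mk_eq_top (N.proc v).trans) m
    obtain ⟨y, rfl⟩ := exists_prod_pow_eq (closure_range_mk_eq_top (N.proc v).trans) m'
    exact ⟨x, y, hm⟩
  choose x y hxy using hlocal
  refine ⟨fun a => x a.1 a.2, fun a => y a.1 a.2, funext fun v => ?_⟩
  simpa only [localAct_snd_apply] using hxy v

theorem IsIrreducible.sub_mem_totalKernel [∀ v, Finite (Q v)] (hirr : N.IsIrreducible)
    {x y : (Σ v, A v) → ℕ} {q : ∀ v, Q v}
    (h : (N.localAct x (0, q)).2 = (N.localAct y (0, q)).2) : xᶻ - yᶻ ∈ N.totalKernel :=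
  fun v => AbelianProcessor.IsIrreducible.sub_mem_kernel (hirr v) (by
    rw [← localAct_snd_apply, ← localAct_snd_apply, h])

end LocalAction

section Production

variable [Fintype V] [∀ v, Fintype (A v)] [∀ v, Finite (Q v)] {q : ∀ v, Q v}
  (hq : N.LocallyRecurrent q)

theorem localAct_eq_production (k : (Σ v, A v) → ℕ) (hk : kᶻ ∈ N.totalKernel) :
    N.localAct k (0, q) = (N.production hq ⟨_, hk⟩, q) :=
  (N.exists_production hq).choose_spec k hk

theorem production_sub {x y : (Σ v, A v) → ℕ} (h : xᶻ - yᶻ ∈ N.totalKernel) :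
    N.production hq ⟨_, h⟩ = (N.localAct x (0, q)).1 - (N.localAct y (0, q)).1 := by
  obtain ⟨l, m, hl, hm, hlm⟩ := N.exists_diff _ h
  have hsum : m + x = l + y := by
    funext a
    have := congrFun hlm a
    simp only [Pi.sub_apply] at this
    simp only [Pi.add_apply]
    omega
  have hsent := N.localAct_add hq m x hm
  rw [hsum, N.localAct_add hq l y hl, localAct_eq_production hq l hl,
    localAct_eq_production hq m hm] at hsent
  have hdiff : (⟨_, h⟩ : N.totalKernel) = ⟨_, hl⟩ - ⟨_, hm⟩ := Subtype.ext hlm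
  rw [hdiff, map_sub, sub_eq_sub_iff_add_eq_add, hsent, add_comm]

end Production

section GlobalAction

variable (hN : N.HaltsOnAllInputs)

theorem globalAct_zero (q : ∀ v, Q v) : globalAct hN 0 q = q :=
  globalAct_eq hN 0 q [] trivial fun _ => le_rfl

theorem globalAct_eq_of_exec_eq {x y : (Σ v, A v) → ℕ} {q r : ∀ v, Q v} {w : List (Σ v, A v)}
    (hw : N.Legal w (xᶻ, q)) (h : N.exec w (xᶻ, q) = (yᶻ, r)) :
    globalAct hN x q = globalAct hN y r := by
  obtain ⟨w', hlegal, hcomplete⟩ := hN y r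
  have hexec : N.exec (w ++ w') (xᶻ, q) = N.exec w' (yᶻ, r) := by rw [exec_append, h]
  rw [globalAct_eq hN y r w' hlegal hcomplete, globalAct_eq hN x q (w ++ w')
    (N.legal_append _ _ _ hw (h ▸ hlegal)) (by rwa [Complete, hexec]), hexec]

theorem tauGen_pow_smul [DecidableEq (Σ v, A v)] (a : Σ v, A v) (n : ℕ) (q : ∀ v, Q v) :
    tauGen hN a ^ n • q = globalAct hN (Pi.single a n) q := by
  induction n with
  | zero => rw [pow_zero, one_smul, Pi.single_zero, globalAct_zero]
  | succ n ih =>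
    have htau (r : ∀ v, Q v) : tauGen hN a • r = globalAct hN (Pi.single a 1) r := by
      change globalAct hN _ r = _
      congr!
    rw [pow_succ', mul_smul, ih, htau, Pi.single_add, globalAct_add]

theorem closure_range_tauGen : Submonoid.closure (Set.range (tauGen hN)) = ⊤ :=
  closure_range_mk_eq_top (tau hN)

variable [Fintype V] [∀ v, Fintype (A v)]

theorem prod_tauGen_pow_smul (x : (Σ v, A v) → ℕ) (q : ∀ v, Q v) :
    (∏ a, tauGen hN a ^ x a) • q = globalAct hN x q := by
  classical
  suffices ∀ s : Finset (Σ v, A v), (∏ a ∈ s, tauGen hN a ^ x a) • q =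
      globalAct hN (∑ a ∈ s, Pi.single a (x a)) q by
    rw [this, Finset.univ_sum_single]
  intro s
  induction s using Finset.induction_on with
  | empty => rw [Finset.prod_empty, Finset.sum_empty, one_smul, globalAct_zero]
  | insert a s ha ih =>
    rw [Finset.prod_insert ha, Finset.sum_insert ha, mul_smul, ih, tauGen_pow_smul,
      ← globalAct_add, add_comm]

theorem globalAct_localAct {x y : (Σ v, A v) → ℕ} {q : ∀ v, Q v}
    (hy : (N.localAct x (0, q)).1 = yᶻ) :
    globalAct hN y (N.localAct x (0, q)).2 = globalAct hN x q := by
  refine (globalAct_eq_of_exec_eq hN (legal_wordOf x q) ?_).symm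
  rw [← localAct_zero, ← hy]

/-- The vector `u` counts the letters processed by a complete legal execution of `x.q`. -/
theorem exists_localAct_eq_globalAct (x : (Σ v, A v) → ℕ) (q : ∀ v, Q v) :
    ∃ u : (Σ v, A v) → ℕ, N.localAct u (0, q) = (uᶻ - xᶻ, globalAct hN x q) := by
  classical
  obtain ⟨w, hlegal, hcomplete⟩ := hN x q
  have hexhausted : (N.exec w (xᶻ, q)).1 = 0 :=
    le_antisymm hcomplete (N.exec_nonneg _ _ (fun a => Int.natCast_nonneg (x a)) hlegal)
  refine ⟨w.count, ?_⟩
  rw [localAct_count, globalAct_eq hN x q w hlegal hcomplete, ← add_sub_cancel xᶻ w.countᶻ,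
    exec_shift, hexhausted, zero_add, add_sub_cancel]

end GlobalAction

theorem IsIrreducible.isIrreducible_globalMonoid [Finite V] [∀ v, Finite (A v)]
    (hirr : N.IsIrreducible) (hN : N.HaltsOnAllInputs) :
    FiniteMonoid.IsIrreducible (globalMonoid hN) (∀ v, Q v) := by
  have := Fintype.ofFinite V
  have (v : V) := Fintype.ofFinite (A v)
  refine ⟨⟨fun v => (hirr v).1.some⟩, fun q r => ?_⟩
  obtain ⟨x, y, hstate⟩ := hirr.exists_localAct_snd_eq q r
  obtain ⟨x', hx'⟩ := exists_natCast_eq_localAct_fst (N := N) x q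
  obtain ⟨y', hy'⟩ := exists_natCast_eq_localAct_fst (N := N) y r
  have hglobal : globalAct hN (x + y') q = globalAct hN (y + x') r := by
    rw [globalAct_add, ← globalAct_localAct hN hx', globalAct_add, ← globalAct_localAct hN hy',
      hstate, ← globalAct_add, ← globalAct_add, add_comm]
  exact ⟨_, _, (prod_tauGen_pow_smul hN _ q).trans
    (hglobal.trans (prod_tauGen_pow_smul hN _ r).symm)⟩

section CriticalGroup

variable [Fintype V] [∀ v, Fintype (A v)] [∀ v, Finite (Q v)] (hN : N.HaltsOnAllInputs)

theorem toCrit_surjective : Function.Surjective (toCrit hN) :=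
  latticeHom_mk_surjective (closure_range_tauGen hN)

theorem toCrit_eq_iff_exists_globalAct_eq (hirr : N.IsIrreducible) (x y : (Σ v, A v) → ℕ)
    (q : ∀ v, Q v) :
    toCrit hN xᶻ = toCrit hN yᶻ ↔ ∃ z, globalAct hN (z + x) q = globalAct hN (z + y) q := by
  simp only [← prod_tauGen_pow_smul]
  exact (hirr.isIrreducible_globalMonoid hN).latticeHom_mk_eq_iff (closure_range_tauGen hN) x y q

variable {q : ∀ v, Q v} (hq : N.LocallyRecurrent q)

theorem exists_natCast_eq_production (k : (Σ v, A v) → ℕ) (hk : kᶻ ∈ N.totalKernel) :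
    ∃ y : (Σ v, A v) → ℕ, N.production hq ⟨_, hk⟩ = yᶻ ∧
      globalAct hN y q = globalAct hN k q := by
  obtain ⟨y, hy⟩ := exists_natCast_eq_localAct_fst (N := N) k q
  have hact := globalAct_localAct hN hy
  rw [localAct_eq_production hq k hk] at hy hact
  exact ⟨y, hy, hact⟩

theorem sub_mem_range_of_globalAct_eq (hirr : N.IsIrreducible) {x y : (Σ v, A v) → ℕ}
    (h : globalAct hN x q = globalAct hN y q) :
    xᶻ - yᶻ ∈ (N.totalKernel.subtype - N.production hq).range := by
  obtain ⟨u, hu⟩ := exists_localAct_eq_globalAct hN x q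
  obtain ⟨u', hu'⟩ := exists_localAct_eq_globalAct hN y q
  have hK : uᶻ - u'ᶻ ∈ N.totalKernel := hirr.sub_mem_totalKernel (by rw [hu, hu', h])
  refine ⟨⟨_, hK⟩, ?_⟩
  rw [AddMonoidHom.sub_apply, AddSubgroup.subtype_apply, production_sub hq hK, hu, hu',
    sub_sub_sub_comm uᶻ xᶻ, sub_sub_cancel]

theorem exists_globalAct_eq_of_sub_mem_range {x y : (Σ v, A v) → ℕ}
    (h : xᶻ - yᶻ ∈ (N.totalKernel.subtype - N.production hq).range) :
    ∃ z, globalAct hN (z + x) q = globalAct hN (z + y) q := by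
  obtain ⟨k, hk⟩ := h
  obtain ⟨l, m, hl, hm, hlm⟩ := N.exists_diff k.1 k.2
  obtain rfl : k = ⟨_, hl⟩ - ⟨_, hm⟩ := Subtype.ext hlm
  obtain ⟨l', hPl, hl'⟩ := exists_natCast_eq_production hN hq l hl
  obtain ⟨m', hPm, hm'⟩ := exists_natCast_eq_production hN hq m hm
  have hsum : l' + (m + x) = m' + (l + y) := by
    rw [map_sub, AddMonoidHom.sub_apply, AddMonoidHom.sub_apply, hPl, hPm] at hk
    funext a
    have := congrFun hk a
    simp only [AddSubgroup.subtype_apply, Pi.sub_apply] at this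
    simp only [Pi.add_apply]
    omega
  refine ⟨l + m, ?_⟩
  calc globalAct hN (l + m + x) q = globalAct hN (l' + (m + x)) q := by
        rw [add_assoc, globalAct_add, ← hl', ← globalAct_add]
    _ = globalAct hN (m + (l + y)) q := by
        rw [hsum, globalAct_add, hm', ← globalAct_add]
    _ = globalAct hN (l + m + y) q := by rw [← add_assoc, add_comm m l]

theorem exists_globalAct_eq_iff_sub_mem_range (hirr : N.IsIrreducible) (x y : (Σ v, A v) → ℕ) :
    (∃ z, globalAct hN (z + x) q = globalAct hN (z + y) q) ↔
      xᶻ - yᶻ ∈ (N.totalKernel.subtype - N.production hq).range := by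
  refine ⟨fun ⟨z, hz⟩ => ?_, exists_globalAct_eq_of_sub_mem_range hN hq⟩
  have hmem := sub_mem_range_of_globalAct_eq hN hq hirr hz
  rwa [natCast_pi_add, natCast_pi_add, add_sub_add_left_eq_sub] at hmem

theorem ker_toCrit (hirr : N.IsIrreducible) :
    (toCrit hN).ker = (N.totalKernel.subtype - N.production hq).range := by
  ext x
  obtain ⟨u, v, rfl⟩ := exists_eq_natCast_pi_sub x
  rw [AddMonoidHom.mem_ker, map_sub, sub_eq_zero, toCrit_eq_iff_exists_globalAct_eq hN hirr u v q,
    exists_globalAct_eq_iff_sub_mem_range hN hq hirr]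

end CriticalGroup

end AbelianNetwork

theorem theorem3p12 {V : Type*} [Fintype V] (G : Digraph V) (A Q : V → Type*)
    [∀ v, Fintype (A v)] [∀ v, Finite (Q v)] (N : AbelianNetwork G A Q)
    (hirr : N.IsIrreducible) (hN : N.HaltsOnAllInputs)
    (q : ∀ v, Q v) (hq : N.LocallyRecurrent q) :
    ∃ Φ : (((Σ v, A v) → ℤ) ⧸ (N.totalKernel.subtype - N.production hq).range) ≃+
        Additive (AbelianNetwork.Crit hN),
      ∀ x : (Σ v, A v) → ℤ, Φ (QuotientAddGroup.mk x) = AbelianNetwork.toCrit hN x :=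
  ⟨(QuotientAddGroup.quotientAddEquivOfEq (AbelianNetwork.ker_toCrit hN hq hirr).symm).trans
    (QuotientAddGroup.quotientKerEquivOfSurjective _ (AbelianNetwork.toCrit_surjective hN)),
    fun _ => rfl⟩
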